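/- Let $d\ge 0$ be an integer. For a complex $d\times d$ matrix $W$ put $\Im W:=\frac1{2\mathrm i}(W-W^\dagger)$, where $W^\dagger$ is the Hermitian conjugate; this matrix is Hermitian, and for Hermitian $H$ we write $H\le 0$ if $v^\dagger H v\le 0$ for all $v\in\mathbb C^d$. A function $A$ from $]0,\infty[$ to the real $d\times d$ matrices is called a matrix-valued Stieltjes function if $A(x)$ is symmetric positive semi-definite for every $x>0$ and $A$ has an analytic continuation to $\mathbb C\setminus\,]-\infty,0]$, again denoted by $A$, such that $(\Im z)\,\Im A(z)\le 0$ for all $z\in\mathbb C\setminus\,]-\infty,0]$. **Theorem.** If $A$ is a matrix-valued Stieltjes function, then there are symmetric positive semi-definite real $d\times d$ matrices $B$ and $C$, a positive Radon measure $\mu$ on $]0,\infty[$ with $$\int_{]0,\infty[}\frac{\mu(\mathrm dr)}{1+r}<\infty ,$$ and a measurable function $M$ with values in the real $d\times d$ matrices, which is $\mu$-almost everywhere bounded and $\mu$-almost everywhere symmetric positive semi-definite, such that for every $x>0$ the function $s\mapsto (x+s)^{-1}M(s)$ is $\mu$-integrable over $]0,\infty[$ and $$A(x)=B+x^{-1}C+\int_{]0,\infty[}(x+s)^{-1}M(s)\,\mu(\mathrm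 ds).$$ -/

import Mathlib

open Set MeasureTheory
open scoped ComplexOrder ComplexStarModule

/-- Matrix-valued Stieltjes functions. `A x` matters only for `x > 0`. The Hermitian imaginary part
`ℑ W = (W - Wᴴ) / (2i)` of a complex matrix `W` is Mathlib's `imaginaryPart`, and analyticity of a
matrix-valued function is analyticity of its entries. -/
structure IsMatrixStieltjes {d : ℕ} (A : ℝ → Matrix (Fin d) (Fin d) ℝ) : Prop where
  /-- the values on the open half-line are (symmetric) positive semi-definite -/
  posSemidef : ∀ x : ℝ, 0 < x → (A x).PosSemidef
  /-- `A` extends analytically to `ℂ ∖ ]-∞, 0]` with `Im z * Im A(z) ≤ 0` -/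
  continuation : ∃ F : ℂ → Matrix (Fin d) (Fin d) ℂ,
    (∀ i j, AnalyticOnNhd ℂ (fun z => F z i j) Complex.slitPlane) ∧
    (∀ x : ℝ, 0 < x → F (x : ℂ) = (A x).map (fun t : ℝ => (t : ℂ))) ∧
    (∀ z ∈ Complex.slitPlane,
      (-(z.im • (ℑ (F z) : Matrix (Fin d) (Fin d) ℂ))).PosSemidef)

/-- The entrywise integral of a matrix-valued function over `]0, ∞[`. -/
noncomputable def matrixIntegral {d : ℕ} (μ : Measure ℝ)
    (N : ℝ → Matrix (Fin d) (Fin d) ℝ) : Matrix (Fin d) (Fin d) ℝ :=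
  Matrix.of fun i j => ∫ s in Ioi (0 : ℝ), N s i j ∂μ

/-!
The map `φ w = ((1 + w) / (1 - w)) ^ 2` sends the unit disc conformally onto the slit plane, real
points to positive reals, and `Im (φ w)` has the sign of `Im w`. Let `G = F ∘ φ` be the pulled back
continuation and `0 < r < 1`. Subtracting the mean value formula for `G (r z) / (1 - w z)` from
Cauchy's formula for `G (r ·)` on the unit circle gives, for real `w` in the disc, with
`p = (1 - cos t) / 2`,

  `Re G(0) - Re G(r w) = ∫ 4 w / ((1 - w)² + 4 w p) * ρ_r(t) dt`,
  `ρ_r(t) = -(sin t / 4π) Im G(r exp(it))`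

(`re_sub_re_eq_integral_im`), and the hypothesis `Im z * Im F(z) ≤ 0` says exactly that the real
matrix `ρ_r(t)` is positive semi-definite all around the circle. At `w = 1 / 2` the formula bounds
`∫ tr ρ_r` independently of `r`.

As `r → 1`, matrix-valued weak compactness is reduced to the scalar one: the laws of
`(p, ρ_r / tr ρ_r)`, weighted by `tr ρ_r dt`, live on a compact set of pairs (point of `[0, 1]`,
positive semi-definite matrix with entries in `[-1, 1]`). A weak limit of them is disintegrated over
its first marginal `τ`, and the conditional mean of the second component is a bounded positive
semi-definite density `N` (`exists_matrix_measure_of_tendsto`). With `x = φ w` this reads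

  `A(x) = A(1) - ∫ (x - 1) / (1 - s + s x) N(s) τ(ds)` over `[0, 1]`,

together with its trace, in which `tr N` is replaced by `1`
(`IsMatrixStieltjes.exists_unitInterval_representation`).

Since `tr A(x) ≥ 0`, letting `x → ∞` in the trace formula and using Fatou's lemma gives
`∫ s⁻¹ τ(ds) ≤ tr A(1)`; in particular `τ` has no mass at `0`. The identity
`(x - 1) / (1 - s + s x) = s⁻¹ - s⁻² / (x + (s⁻¹ - 1))` then separates the constant term
`B = A(1) - ∫ s⁻¹ N dτ`, which is the limit of `A` at infinity and so positive semi-definite, from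
the point `s = 1`, which contributes `x⁻¹ C`, and the rest, which the substitution `s ↦ s⁻¹ - 1`
turns into an integral over `]0, ∞[`.
-/

/-! ### An integral formula on the disc -/

open Metric in
/-- On the unit circle the kernel is purely imaginary when `w` is real, since then `1 / (1 - w z)`
is the complex conjugate of `z / (z - w)`. -/
theorem sub_eq_circleAverage_of_diffContOnCl {H : ℂ → ℂ} (hH : DiffContOnCl ℂ H (ball 0 1))
    {w : ℂ} (hw : ‖w‖ < 1) :
    H w - H 0 = Real.circleAverage (fun z => (z / (z - w) - 1 / (1 - w * z)) * H z) 0 1 := by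
  have hne1 : ∀ z ∈ closedBall (0 : ℂ) 1, 1 - w * z ≠ 0 := by
    intro z hz h
    have h1 : ‖w * z‖ < 1 := by
      rw [norm_mul]
      have : ‖z‖ ≤ 1 := by simpa using hz
      nlinarith [norm_nonneg w, norm_nonneg z]
    rw [← sub_eq_zero.mp h] at h1
    simp at h1
  have hne2 : ∀ z ∈ sphere (0 : ℂ) 1, z - w ≠ 0 := by
    intro z hz h
    rw [sub_eq_zero.mp h] at hz
    simp at hz
    linarith
  have hHc : ContinuousOn H (closedBall 0 1) := hH.continuousOn_ball
  have hd : DiffContOnCl ℂ (fun z => 1 / (1 - w * z) * H z) (ball 0 1) := by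
    refine ⟨?_, ?_⟩
    · refine DifferentiableOn.mul (DifferentiableOn.div (by fun_prop) (by fun_prop) ?_) hH.1
      exact fun z hz => hne1 z (ball_subset_closedBall hz)
    · rw [closure_ball _ one_ne_zero]
      refine ContinuousOn.mul (ContinuousOn.div (by fun_prop) (by fun_prop) hne1) hHc
  have e1 := DiffContOnCl.circleAverage_smul_div (c := 0) (R := 1) (f := H) (w := w)
    (by simpa using hH) (by simpa using hw)
  have e2 : Real.circleAverage (fun z => 1 / (1 - w * z) * H z) 0 1 = H 0 := by
    rw [DiffContOnCl.circleAverage (by rwa [abs_one])]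
    simp
  simp only [sub_zero, smul_eq_mul] at e1
  have hHs : ContinuousOn H (sphere 0 1) := hHc.mono sphere_subset_closedBall
  rw [← e1, ← e2, ← Real.circleAverage_fun_sub]
  · simp only [sub_mul]
  · refine ContinuousOn.circleIntegrable zero_le_one ?_
    exact ContinuousOn.mul (ContinuousOn.div (by fun_prop) (by fun_prop) hne2) hHs
  · refine ContinuousOn.circleIntegrable zero_le_one ?_
    exact ContinuousOn.mul (ContinuousOn.div (by fun_prop) (by fun_prop)
      fun z hz => hne1 z (sphere_subset_closedBall hz)) hHs

theorem kernel_den_pos {w : ℝ} (hw : |w| < 1) {p : ℝ} (hp : p ∈ Icc (0 : ℝ) 1) :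
    0 < (1 - w) ^ 2 + 4 * w * p := by
  rw [abs_lt] at hw
  have h : (1 - w) ^ 2 + 4 * w * p = (1 - p) * (1 - w) ^ 2 + p * (1 + w) ^ 2 := by ring
  have h1 : 0 < (1 - w) ^ 2 := by nlinarith
  have h2 : 0 < (1 + w) ^ 2 := by nlinarith
  rw [h]
  rcases hp.1.eq_or_lt with h0 | h0
  · rw [← h0]; simpa using h1
  · exact add_pos_of_nonneg_of_pos (mul_nonneg (by linarith [hp.2]) h1.le) (mul_pos h0 h2)

theorem one_sub_cos_div_two_mem (t : ℝ) : (1 - Real.cos t) / 2 ∈ Icc (0 : ℝ) 1 :=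
  ⟨by linarith [Real.cos_le_one t], by linarith [Real.neg_one_le_cos t]⟩

open Metric in
/-- The value of a holomorphic function at a real point of the disc, relative to its value at `0`, in
terms of its imaginary part on the unit circle. The factor `-sin t * Im H` of the integrand is
nonnegative when `Im z * Im H z ≤ 0`. -/
theorem re_sub_re_eq_integral_im {H : ℂ → ℂ} (hH : DiffContOnCl ℂ H (ball 0 1))
    {w : ℝ} (hw : |w| < 1) :
    (H 0).re - (H w).re = ∫ t in Ioc 0 (2 * Real.pi),
      4 * w / ((1 - w) ^ 2 + 4 * w * ((1 - Real.cos t) / 2)) *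
        (-(Real.sin t / (4 * Real.pi)) * (H (circleMap 0 1 t)).im) := by
  have hHs : Continuous fun t => H (circleMap 0 1 t) :=
    hH.continuousOn_ball.comp_continuous (continuous_circleMap 0 1)
      fun t => sphere_subset_closedBall (circleMap_mem_sphere 0 zero_le_one t)
  have key := sub_eq_circleAverage_of_diffContOnCl hH (w := w) (by simpa using hw)
  have hkernel : ∀ t : ℝ, (circleMap 0 1 t / (circleMap 0 1 t - w) - 1 / (1 - w * circleMap 0 1 t)) =
      ((2 * w * Real.sin t / ((1 - w) ^ 2 + 4 * w * ((1 - Real.cos t) / 2)) : ℝ) : ℂ) *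
        (-Complex.I) := by
    intro t
    have hD := (kernel_den_pos hw (one_sub_cos_div_two_mem t)).ne'
    have hz : circleMap 0 1 t = Real.cos t + Real.sin t * Complex.I := by
      simp [circleMap, Complex.exp_mul_I]
    have hsc : ((Real.sin t : ℝ) : ℂ) ^ 2 + (Real.cos t : ℂ) ^ 2 = 1 := by
      exact_mod_cast Real.sin_sq_add_cos_sq t
    have hI := Complex.I_sq
    set c : ℂ := (Real.cos t : ℂ)
    set s : ℂ := (Real.sin t : ℂ)
    have hDC : (((1 - w) ^ 2 + 4 * w * ((1 - Real.cos t) / 2) : ℝ) : ℂ) ≠ 0 := by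
      exact_mod_cast hD
    -- `|z - w|²`, with `c - s * I` the conjugate of `z = c + s * I`
    have hprod : (circleMap 0 1 t - w) * ((c - s * Complex.I) - w) =
        (((1 - w) ^ 2 + 4 * w * ((1 - Real.cos t) / 2) : ℝ) : ℂ) := by
      rw [hz]
      simp only [Complex.ofReal_add, Complex.ofReal_mul, Complex.ofReal_sub, Complex.ofReal_pow,
        Complex.ofReal_div, Complex.ofReal_one, Complex.ofReal_ofNat]
      linear_combination hsc - s ^ 2 * hI
    have hzz : (c + s * Complex.I) * (c - s * Complex.I) = 1 := by
      linear_combination hsc - s ^ 2 * hI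
    have h1 : circleMap 0 1 t - w ≠ 0 := fun h => hDC (by rw [← hprod, h, zero_mul])
    have h2' : (c - s * Complex.I) - w ≠ 0 := fun h => hDC (by rw [← hprod, h, mul_zero])
    have h3 : 1 - w * circleMap 0 1 t = (c + s * Complex.I) * ((c - s * Complex.I) - w) := by
      rw [hz]; linear_combination -hzz
    have h4 : c + s * Complex.I ≠ 0 := left_ne_zero_of_mul_eq_one hzz
    rw [h3, Complex.ofReal_div, ← hprod]
    rw [hz] at h1 ⊢
    simp only [Complex.ofReal_mul, Complex.ofReal_ofNat]
    field_simp
    linear_combination (c + s * Complex.I - w) * hzz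
  have hInt : IntervalIntegrable (fun t => (circleMap 0 1 t / (circleMap 0 1 t - w) -
      1 / (1 - w * circleMap 0 1 t)) * H (circleMap 0 1 t)) volume 0 (2 * Real.pi) := by
    refine Continuous.intervalIntegrable ?_ _ _
    simp_rw [hkernel]
    refine Continuous.mul (Continuous.mul (Complex.continuous_ofReal.comp ?_) continuous_const) hHs
    exact Continuous.div (by fun_prop) (by fun_prop)
      fun t => (kernel_den_pos hw (one_sub_cos_div_two_mem t)).ne'
  have hre : ((H w - H 0).re : ℝ) = (2 * Real.pi)⁻¹ * ∫ t in 0..2 * Real.pi,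
      ((circleMap 0 1 t / (circleMap 0 1 t - w) -
        1 / (1 - w * circleMap 0 1 t)) * H (circleMap 0 1 t)).re := by
    rw [key, Real.circleAverage_def, Complex.real_smul, Complex.re_ofReal_mul]
    congr 1
    have := Complex.reCLM.intervalIntegral_comp_comm hInt
    simpa using this.symm
  rw [← neg_sub, ← Complex.sub_re, hre, ← intervalIntegral.integral_of_le (by positivity),
    ← intervalIntegral.integral_const_mul, ← intervalIntegral.integral_neg]
  refine intervalIntegral.integral_congr fun t _ => ?_
  simp only [hkernel]
  have hD := (kernel_den_pos hw (one_sub_cos_div_two_mem t)).ne'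
  rw [mul_assoc, Complex.re_ofReal_mul]
  simp
  field_simp

/-! ### Weak limits of weighted laws on a compact set -/

section WeakLimit

open Filter Topology

/-- Helly selection: the laws of `q n` under `ω n • P`, of bounded mass and carried by a compact set,
have a weak cluster point `m`. Convergence is asked only along the given sequence for the integrals
one wants to identify. -/
theorem exists_measure_integral_eq_of_tendsto {Ω E : Type*} [MeasurableSpace Ω]
    [TopologicalSpace E] [T2Space E] [NormalSpace E] [MeasurableSpace E] [BorelSpace E]
    {P : Measure Ω} {K : Set E} (hK : IsCompact K) {q : ℕ → Ω → E} (hq : ∀ n, Measurable (q n))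
    (hqK : ∀ n t, q n t ∈ K) {ω : ℕ → Ω → ℝ} (hω : ∀ n, Measurable (ω n))
    (hω0 : ∀ n t, 0 ≤ ω n t) (hωi : ∀ n, Integrable (ω n) P) {C : ℝ}
    (hC : ∀ n, ∫ t, ω n t ∂P ≤ C) :
    ∃ m : Measure E, IsFiniteMeasure m ∧ m Kᶜ = 0 ∧ ∀ (f : E → ℝ) (a : ℝ), ContinuousOn f K →
      Tendsto (fun n => ∫ t, ω n t * f (q n t) ∂P) atTop (𝓝 a) → ∫ x, f x ∂m = a := by
  let ν' : ℕ → Measure E := fun n => (P.withDensity fun t => ENNReal.ofReal (ω n t)).map (q n)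
  have hmass : ∀ n, ν' n univ = ENNReal.ofReal (∫ t, ω n t ∂P) := by
    intro n
    simp only [ν']
    rw [Measure.map_apply (hq n) MeasurableSet.univ, preimage_univ,
      withDensity_apply _ MeasurableSet.univ, Measure.restrict_univ,
      ofReal_integral_eq_lintegral_ofReal (hωi n) (ae_of_all _ (hω0 n))]
  let ν : ℕ → FiniteMeasure E := fun n => ⟨ν' n, ⟨by rw [hmass]; exact ENNReal.ofReal_lt_top⟩⟩
  have hνint : ∀ n (g : E → ℝ), Continuous g →
      ∫ x, g x ∂(ν n : Measure E) = ∫ t, ω n t * g (q n t) ∂P := by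
    intro n g hg
    change ∫ x, g x ∂(ν' n) = _
    simp only [ν']
    rw [integral_map (hq n).aemeasurable hg.measurable.aestronglyMeasurable,
      integral_withDensity_eq_integral_toReal_smul (hω n).ennreal_ofReal (by simp)]
    simp only [smul_eq_mul, ENNReal.toReal_ofReal (hω0 n _)]
  have hT := isCompact_setOfPred_finiteMeasure_le_of_isCompact C.toNNReal hK
  let u : Ultrafilter ℕ := Ultrafilter.of atTop
  have hu : (u : Filter ℕ) ≤ atTop := Ultrafilter.of_le _
  obtain ⟨m, ⟨-, hmK⟩, hm⟩ := hT.ultrafilter_le_nhds' (u.map ν) (by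
    rw [Ultrafilter.mem_map]
    refine Filter.univ_mem' fun n => ⟨?_, ?_⟩
    · have : ((ν n).mass : ENNReal) = ENNReal.ofReal (∫ t, ω n t ∂P) := by
        rw [FiniteMeasure.ennreal_mass]; exact hmass n
      rw [← ENNReal.coe_le_coe, this]
      exact ENNReal.ofReal_le_ofReal (hC n)
    · rw [FiniteMeasure.null_iff_toMeasure_null]
      change ν' n Kᶜ = 0
      have : q n ⁻¹' Kᶜ = ∅ := eq_empty_of_forall_notMem fun t ht => ht (hqK n t)
      simp only [ν']
      rw [Measure.map_apply (hq n) hK.measurableSet.compl, this, measure_empty])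
  refine ⟨m, inferInstance, (FiniteMeasure.null_iff_toMeasure_null _ _).1 hmK, fun f a hf ha => ?_⟩
  -- replace `f` by a bounded continuous function that agrees with it on `K`
  have : CompactSpace K := isCompact_iff_compactSpace.mp hK
  obtain ⟨g, -, hg⟩ := BoundedContinuousFunction.exists_norm_eq_domRestrict_eq_of_closed
    (BoundedContinuousFunction.mkOfCompact ⟨K.domRestrict f, hf.domRestrict⟩) hK.isClosed
  have hgf : ∀ x ∈ K, g x = f x := fun x hx => by simpa using! DFunLike.congr_fun hg ⟨x, hx⟩
  have hlim : Tendsto ν u (𝓝 m) := hm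
  have h1 := FiniteMeasure.tendsto_iff_forall_integral_tendsto.1 hlim g
  simp only [hνint _ _ g.continuous, hgf _ (hqK _ _)] at h1
  rw [← tendsto_nhds_unique h1 (ha.mono_left hu)]
  refine integral_congr_ae ?_
  have : ∀ᵐ x ∂(m : Measure E), x ∈ K := (FiniteMeasure.null_iff_toMeasure_null _ _).1 hmK
  filter_upwards [this] with x hx using (hgf x hx).symm

end WeakLimit

/-! ### Positive semi-definite matrices with bounded entries -/

section PSD

variable {ι : Type*} [Fintype ι]

/-- Test the form on `e_i + e_j` and `e_i - e_j`. -/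
theorem Matrix.PosSemidef.abs_apply_le_trace {N : Matrix ι ι ℝ} (hN : N.PosSemidef) (i j : ι) :
    |N i j| ≤ N.trace := by
  classical
  have hd : ∀ k, 0 ≤ N k k := fun k => hN.diag_nonneg
  have hle : ∀ k, N k k ≤ N.trace := fun k =>
    Finset.single_le_sum (f := fun k => N k k) (fun k _ => hd k) (Finset.mem_univ k)
  have hs : N j i = N i j := by simpa using hN.isHermitian.apply i j
  have h1 := hN.dotProduct_mulVec_nonneg (Pi.single i 1 + Pi.single j 1)
  have h2 := hN.dotProduct_mulVec_nonneg (Pi.single i 1 - Pi.single j 1)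
  simp [Matrix.mulVec_add, Matrix.mulVec_sub, add_dotProduct, sub_dotProduct, hs] at h1 h2
  rw [abs_le]
  constructor <;> linarith [hle i, hle j]

/-- The compact convex set of positive semi-definite matrices with entries in `[-1, 1]`, inside the
normed space of functions `ι → ι → ℝ`. -/
def psdUnitSet (ι : Type*) [Fintype ι] : Set (ι → ι → ℝ) :=
  {N | (Matrix.of N).PosSemidef ∧ ∀ i j, |N i j| ≤ 1}

theorem isClosed_posSemidef : IsClosed {N : ι → ι → ℝ | (Matrix.of N).PosSemidef} := by
  simp only [Matrix.posSemidef_iff_dotProduct_mulVec, Matrix.IsHermitian, ← Matrix.ext_iff,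
    ofPred_and, ofPred_forall]
  refine IsClosed.inter (isClosed_iInter fun i => isClosed_iInter fun j => ?_)
    (isClosed_iInter fun v => ?_)
  · simp only [Matrix.conjTranspose_apply, Matrix.of_apply, star_trivial]
    exact isClosed_eq (by fun_prop) (by fun_prop)
  · simp only [dotProduct, Matrix.mulVec, Matrix.of_apply]
    exact isClosed_le continuous_const (by fun_prop)

theorem isCompact_psdUnitSet : IsCompact (psdUnitSet ι) := by
  have h : psdUnitSet ι = {N | (Matrix.of N).PosSemidef} ∩
      Set.univ.pi fun _ => Set.univ.pi fun _ => Icc (-1) 1 := by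
    ext N
    simp only [psdUnitSet, abs_le, mem_ofPred_eq, mem_inter_iff, mem_univ_pi, mem_Icc]
  rw [h]
  exact (isCompact_univ_pi fun _ => isCompact_univ_pi fun _ => isCompact_Icc).inter_left
    isClosed_posSemidef

theorem convex_psdUnitSet : Convex ℝ (psdUnitSet ι) := by
  rintro N ⟨hN, hN1⟩ N' ⟨hN', hN1'⟩ a b ha hb hab
  refine ⟨(hN.smul ha).add (hN'.smul hb), fun i j => ?_⟩
  have h1 := abs_le.1 (hN1 i j)
  have h2 := abs_le.1 (hN1' i j)
  simp only [Pi.add_apply, Pi.smul_apply, smul_eq_mul]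
  rw [abs_le]
  constructor <;> nlinarith

theorem zero_mem_psdUnitSet : (0 : ι → ι → ℝ) ∈ psdUnitSet ι :=
  ⟨Matrix.PosSemidef.zero, by simp⟩

/-- This includes the case of trace `0`, in which `N = 0` and the normalisation is `0` as well. -/
theorem inv_trace_smul_mem_psdUnitSet {N : Matrix ι ι ℝ} (hN : N.PosSemidef) :
    (fun i j => N.trace⁻¹ * N i j) ∈ psdUnitSet ι := by
  have h0 : 0 ≤ N.trace := hN.trace_nonneg
  refine ⟨hN.smul (inv_nonneg.2 h0), fun i j => ?_⟩
  rw [abs_mul, abs_of_nonneg (inv_nonneg.2 h0), inv_mul_eq_div]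
  exact div_le_one_of_le₀ (hN.abs_apply_le_trace i j) h0

end PSD

/-! ### Weak limits of matrix-valued densities -/

section Disintegration
open Filter Topology ProbabilityTheory
variable {ι : Type*} [Fintype ι]

/-- The density `M` is the conditional mean of the matrix component given the real one. -/
theorem exists_density_of_measure_prod (m : Measure (ℝ × (ι → ι → ℝ))) [IsFiniteMeasure m]
    (hm : ∀ᵐ x ∂m, x.2 ∈ psdUnitSet ι) :
    ∃ M : ℝ → (ι → ι → ℝ), Measurable M ∧ (∀ s, M s ∈ psdUnitSet ι) ∧
      ∀ (g : ℝ → ℝ) (i j : ι), Integrable g m.fst →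
        ∫ x, g x.1 * x.2 i j ∂m = ∫ s, g s * M s i j ∂m.fst := by
  classical
  have hS : MeasurableSet (psdUnitSet ι) := isCompact_psdUnitSet.measurableSet
  -- truncating to `psdUnitSet` makes the properties of the conditional mean hold everywhere
  let φ : (ι → ι → ℝ) → (ι → ι → ℝ) := (psdUnitSet ι).indicator id
  have hφ : Measurable φ := measurable_id.indicator hS
  have hφS : ∀ N, φ N ∈ psdUnitSet ι := by
    intro N
    by_cases h : N ∈ psdUnitSet ι
    · simp [φ, h]
    · simpa [φ, h] using zero_mem_psdUnitSet
  have hφb : ∀ N, ‖φ N‖ ≤ 1 := fun N =>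
    (pi_norm_le_iff_of_nonneg zero_le_one).2 fun i =>
      (pi_norm_le_iff_of_nonneg zero_le_one).2 fun j => (hφS N).2 i j
  have hφi : ∀ s, Integrable φ (m.condKernel s) := fun s =>
    Integrable.of_bound hφ.aestronglyMeasurable 1 (ae_of_all _ hφb)
  refine ⟨fun s => ∫ N, φ N ∂(m.condKernel s), ?_, ?_, ?_⟩
  · exact (StronglyMeasurable.integral_kernel hφ.stronglyMeasurable).measurable
  · exact fun s => convex_psdUnitSet.integral_mem isCompact_psdUnitSet.isClosed
      (ae_of_all _ hφS) (hφi s)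
  · intro g i j hg
    have h1 : ∫ x, g x.1 * x.2 i j ∂m = ∫ x, g x.1 * φ x.2 i j ∂m := by
      refine integral_congr_ae ?_
      filter_upwards [hm] with x hx
      simp [φ, hx]
    have hgi : Integrable (fun x : ℝ × (ι → ι → ℝ) => g x.1) m :=
      hg.comp_measurable measurable_fst
    have hint : Integrable (fun x : ℝ × (ι → ι → ℝ) => g x.1 * φ x.2 i j) m := by
      refine hgi.mul_bdd (c := 1) ?_ (ae_of_all _ fun x => (hφS x.2).2 i j)
      exact Measurable.aestronglyMeasurable (by fun_prop)
    rw [h1, ← Measure.integral_condKernel hint]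
    refine integral_congr_ae (ae_of_all _ fun s => ?_)
    simp only
    rw [integral_const_mul, eval_integral fun i => Integrable.eval (hφi s) i, eval_integral]
    exact fun j => Integrable.eval (Integrable.eval (hφi s) i) j

/-- A sequence of positive semi-definite matrix densities `ρ n`, with bounded integrals of the trace,
has a cluster point `M • τ` as matrix-valued measures pushed to `[0, 1]` by `p`; the measure `τ` is
the corresponding cluster point of the traces. -/
theorem exists_matrix_measure_of_tendsto {Ω : Type*} [MeasurableSpace Ω] {P : Measure Ω}
    {p : Ω → ℝ} (hp : Measurable p) (hp01 : ∀ t, p t ∈ Icc (0 : ℝ) 1)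
    {ρ : ℕ → Ω → Matrix ι ι ℝ} (hρ : ∀ n i j, Measurable fun t => ρ n t i j)
    (hpsd : ∀ n t, (ρ n t).PosSemidef) (hint : ∀ n, Integrable (fun t => (ρ n t).trace) P)
    {C : ℝ} (hC : ∀ n, ∫ t, (ρ n t).trace ∂P ≤ C) :
    ∃ (τ : Measure ℝ) (M : ℝ → (ι → ι → ℝ)), IsFiniteMeasure τ ∧ (∀ᵐ s ∂τ, s ∈ Icc (0 : ℝ) 1) ∧
      Measurable M ∧ (∀ s, M s ∈ psdUnitSet ι) ∧
      (∀ (g : ℝ → ℝ) (i j : ι) (a : ℝ), ContinuousOn g (Icc 0 1) →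
        Tendsto (fun n => ∫ t, g (p t) * ρ n t i j ∂P) atTop (𝓝 a) →
        ∫ s, g s * M s i j ∂τ = a) ∧
      (∀ (g : ℝ → ℝ) (a : ℝ), ContinuousOn g (Icc 0 1) →
        Tendsto (fun n => ∫ t, g (p t) * (ρ n t).trace ∂P) atTop (𝓝 a) →
        ∫ s, g s ∂τ = a) := by
  have htr : ∀ n, Measurable fun t => (ρ n t).trace := fun n => by
    simp only [Matrix.trace, Matrix.diag]
    exact Finset.measurable_sum _ fun i _ => hρ n i i
  have htr0 : ∀ n t, 0 ≤ (ρ n t).trace := fun n t => (hpsd n t).trace_nonneg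
  obtain ⟨m, hmfin, hmK, hm⟩ := exists_measure_integral_eq_of_tendsto (P := P)
    (isCompact_Icc.prod (isCompact_psdUnitSet (ι := ι)))
    (q := fun n t => (p t, fun i j => (ρ n t).trace⁻¹ * ρ n t i j))
    (fun n => hp.prodMk (measurable_pi_lambda _ fun i => measurable_pi_lambda _ fun j =>
      (htr n).inv.mul (hρ n i j)))
    (fun n t => ⟨hp01 t, inv_trace_smul_mem_psdUnitSet (hpsd n t)⟩) htr htr0 hint hC
  have hae : ∀ᵐ x ∂m, x ∈ Icc (0 : ℝ) 1 ×ˢ psdUnitSet ι := hmK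
  have hae1 : ∀ᵐ s ∂m.fst, s ∈ Icc (0 : ℝ) 1 := by
    rw [Measure.fst]
    exact (ae_map_iff measurable_fst.aemeasurable measurableSet_Icc).2 (hae.mono fun x hx => hx.1)
  obtain ⟨M, hMm, hMS, hM⟩ := exists_density_of_measure_prod m (hae.mono fun x hx => hx.2)
  have hgi : ∀ g : ℝ → ℝ, ContinuousOn g (Icc 0 1) → Integrable g m.fst := by
    intro g hg
    rw [← Measure.restrict_eq_self_of_ae_mem hae1]
    exact hg.integrableOn_compact isCompact_Icc
  refine ⟨m.fst, M, inferInstance, hae1, hMm, hMS, fun g i j a hg ha => ?_, fun g a hg ha => ?_⟩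
  · rw [← hM g i j (hgi g hg)]
    refine hm _ a ?_ ?_
    · exact (hg.comp continuousOn_fst fun x hx => hx.1).mul (by fun_prop)
    · refine ha.congr fun n => integral_congr_ae (ae_of_all _ fun t => ?_)
      -- where the trace vanishes, so does the whole matrix
      by_cases h0 : (ρ n t).trace = 0
      · have := (hpsd n t).abs_apply_le_trace i j
        rw [h0] at this
        simp [abs_nonpos_iff.1 this, h0]
      · simp only
        field_simp
  · have hgm := (hgi g hg).aestronglyMeasurable
    rw [Measure.fst] at hgm ⊢
    rw [integral_map measurable_fst.aemeasurable hgm]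
    refine hm (fun x => g x.1) a (hg.comp continuousOn_fst fun x hx => hx.1) ?_
    exact ha.congr fun n => integral_congr_ae (ae_of_all _ fun t => mul_comm _ _)

end Disintegration

/-! ### The sign condition in real terms, and the conformal map -/

theorem Matrix.PosSemidef.map_re {ι : Type*} [Fintype ι] {X : Matrix ι ι ℂ} (hX : X.PosSemidef) :
    (X.map Complex.re).PosSemidef := by
  refine Matrix.PosSemidef.of_dotProduct_mulVec_nonneg ?_ fun v => ?_
  · ext i j
    have := congrArg Complex.re (hX.isHermitian.apply i j)
    simpa using this
  · have h := (Complex.le_def.1 (hX.dotProduct_mulVec_nonneg fun i => (v i : ℂ))).1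
    simpa [dotProduct, Matrix.mulVec] using h

/-- For real quadratic forms the Hermitian imaginary part may be replaced by the entrywise imaginary
part of the symmetrised matrix, which is a real matrix. -/
theorem posSemidef_symm_im {ι : Type*} [Fintype ι] {W : Matrix ι ι ℂ} {y : ℝ}
    (hW : (-(y • (ℑ W : Matrix ι ι ℂ))).PosSemidef) :
    (Matrix.of fun i j => -y * ((W i j + W j i) / 2).im).PosSemidef := by
  convert hW.map_re using 1
  ext i j
  simp [imaginaryPart_apply_coe]
  left
  ring

/-- The conformal map of the unit disc onto the slit plane. -/
noncomputable def discToSlitPlane (w : ℂ) : ℂ := ((1 + w) / (1 - w)) ^ 2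

theorem one_sub_ne_zero_of_norm_lt {w : ℂ} (hw : ‖w‖ < 1) : 1 - w ≠ 0 := by
  intro h
  rw [← sub_eq_zero.1 h] at hw
  simp at hw

theorem cayley_re_pos {w : ℂ} (hw : ‖w‖ < 1) : 0 < ((1 + w) / (1 - w)).re := by
  have h1 : 0 < Complex.normSq (1 - w) := Complex.normSq_pos.2 (one_sub_ne_zero_of_norm_lt hw)
  have h2 : Complex.normSq w < 1 := by
    rw [Complex.normSq_eq_norm_sq]; nlinarith [norm_nonneg w]
  rw [Complex.div_re, ← add_div]
  refine div_pos ?_ h1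
  rw [Complex.normSq_apply] at h2
  simp
  nlinarith

theorem cayley_im (w : ℂ) : ((1 + w) / (1 - w)).im = 2 * w.im / Complex.normSq (1 - w) := by
  rw [Complex.div_im, ← sub_div]
  simp
  ring

/-- The imaginary part of `discToSlitPlane w` is that of `w` times a positive factor. -/
theorem discToSlitPlane_im (w : ℂ) : (discToSlitPlane w).im =
    4 * ((1 + w) / (1 - w)).re / Complex.normSq (1 - w) * w.im := by
  rw [discToSlitPlane, sq, Complex.mul_im, cayley_im]
  ring

theorem discToSlitPlane_mem {w : ℂ} (hw : ‖w‖ < 1) : discToSlitPlane w ∈ Complex.slitPlane := by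
  have hre := cayley_re_pos hw
  rw [Complex.mem_slitPlane_iff, discToSlitPlane, sq, Complex.mul_re, Complex.mul_im]
  set u := (1 + w) / (1 - w)
  rcases eq_or_ne u.im 0 with h | h
  · left; rw [h]; nlinarith
  · right
    have : u.re * u.im + u.im * u.re = 2 * (u.re * u.im) := by ring
    rw [this]
    exact mul_ne_zero two_ne_zero (mul_ne_zero hre.ne' h)

theorem differentiableAt_discToSlitPlane {w : ℂ} (hw : ‖w‖ < 1) :
    DifferentiableAt ℂ discToSlitPlane w := by
  unfold discToSlitPlane
  exact DifferentiableAt.pow (DifferentiableAt.div (by fun_prop) (by fun_prop)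
    (one_sub_ne_zero_of_norm_lt hw)) 2

theorem discToSlitPlane_ofReal (w : ℝ) :
    discToSlitPlane w = ((((1 + w) / (1 - w)) ^ 2 : ℝ) : ℂ) := by
  simp [discToSlitPlane]

/-! ### The representation over the unit interval -/

open Filter Topology Metric in
/-- A matrix-valued Stieltjes function is an integral of Möbius functions over `[0, 1]`. The points
`s = 0` and `s = 1` correspond to the kernels `x - 1` and `1 - 1 / x`. -/
theorem IsMatrixStieltjes.exists_unitInterval_representation {d : ℕ}
    {A : ℝ → Matrix (Fin d) (Fin d) ℝ} (hA : IsMatrixStieltjes A) :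
    ∃ (τ : Measure ℝ) (M : ℝ → (Fin d → Fin d → ℝ)), IsFiniteMeasure τ ∧
      (∀ᵐ s ∂τ, s ∈ Icc (0 : ℝ) 1) ∧ Measurable M ∧ (∀ s, M s ∈ psdUnitSet (Fin d)) ∧
      ∀ x : ℝ, 0 < x →
        (∀ i j, A x i j = A 1 i j - ∫ s, (x - 1) / (1 - s + s * x) * M s i j ∂τ) ∧
        (A x).trace = (A 1).trace - ∫ s, (x - 1) / (1 - s + s * x) ∂τ := by
  obtain ⟨F, hF, hFA, hFim⟩ := hA.continuation
  let r : ℕ → ℝ := fun n => 1 - 1 / ((n : ℝ) + 2)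
  have hr : ∀ n, 0 < r n ∧ r n < 1 := by
    intro n
    have h : (0 : ℝ) < 1 / ((n : ℝ) + 2) := by positivity
    have h' : 1 / ((n : ℝ) + 2) < 1 := by
      rw [div_lt_one (by positivity)]
      linarith [(Nat.cast_nonneg n : (0 : ℝ) ≤ n)]
    constructor <;> simp only [r] <;> linarith
  have hrlim : Tendsto r atTop (𝓝 1) := by
    have h : Tendsto (fun n : ℕ => (n : ℝ) + 2) atTop atTop :=
      tendsto_atTop_add_const_right _ _ tendsto_natCast_atTop_atTop
    simpa [r] using h.inv_tendsto_atTop.const_sub 1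
  -- the symmetrised entries of the continuation, pulled back to the disc
  let G : Fin d → Fin d → ℂ → ℂ := fun i j z =>
    (F (discToSlitPlane z) i j + F (discToSlitPlane z) j i) / 2
  have hGd : ∀ i j (z : ℂ), ‖z‖ < 1 → DifferentiableAt ℂ (G i j) z := by
    intro i j z hz
    have h := fun i j => ((hF i j _ (discToSlitPlane_mem hz)).differentiableAt).comp z
      (differentiableAt_discToSlitPlane hz)
    exact ((h i j).add (h j i)).div_const 2
  have hGre : ∀ i j (w : ℝ), |w| < 1 → (G i j w).re = A (((1 + w) / (1 - w)) ^ 2) i j := by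
    intro i j w hw
    have hpos : 0 < ((1 + w) / (1 - w)) ^ 2 := by
      rw [abs_lt] at hw
      exact pow_pos (div_pos (by linarith) (by linarith)) 2
    have hs : A (((1 + w) / (1 - w)) ^ 2) j i = A (((1 + w) / (1 - w)) ^ 2) i j := by
      simpa using (hA.posSemidef _ hpos).isHermitian.apply i j
    simp only [G]
    rw [discToSlitPlane_ofReal, hFA _ hpos]
    simp only [Matrix.map_apply, hs, add_self_div_two, Complex.ofReal_re]
  have hnorm : ∀ n (z : ℂ), ‖z‖ ≤ 1 → ‖(r n : ℂ) * z‖ < 1 := by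
    intro n z hz
    rw [norm_mul, Complex.norm_real, Real.norm_eq_abs, abs_of_pos (hr n).1]
    nlinarith [(hr n).1, (hr n).2, norm_nonneg z]
  have hHd : ∀ n i j, DiffContOnCl ℂ (fun z => G i j (r n * z)) (ball 0 1) := by
    intro n i j
    refine DifferentiableOn.diffContOnCl fun z hz => ?_
    rw [closure_ball _ one_ne_zero, mem_closedBall_zero_iff] at hz
    have h := (hGd i j _ (hnorm n z hz)).comp z
      (f := fun z : ℂ => (r n : ℂ) * z) (by fun_prop)
    exact h.differentiableWithinAt
  let p : ℝ → ℝ := fun t => (1 - Real.cos t) / 2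
  -- the densities on the circle; the sign of `sin t` compensates that of the imaginary part
  let ρ : ℕ → ℝ → Matrix (Fin d) (Fin d) ℝ := fun n t => Matrix.of fun i j =>
    -(Real.sin t / (4 * Real.pi)) * (G i j (r n * circleMap 0 1 t)).im
  have hρc : ∀ n i j, Continuous fun t => ρ n t i j := by
    intro n i j
    have : Continuous fun t => G i j (r n * circleMap 0 1 t) :=
      (hHd n i j).continuousOn_ball.comp_continuous (continuous_circleMap 0 1)
        fun t => sphere_subset_closedBall (circleMap_mem_sphere 0 zero_le_one t)
    simp only [ρ, Matrix.of_apply]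
    exact Continuous.mul (by fun_prop) (Complex.continuous_im.comp this)
  have hρpsd : ∀ n t, (ρ n t).PosSemidef := by
    intro n t
    have hz : ‖(r n : ℂ) * circleMap 0 1 t‖ < 1 := hnorm n _ (by simp)
    have him : ((r n : ℂ) * circleMap 0 1 t).im = r n * Real.sin t := by
      rw [Complex.im_ofReal_mul]
      simp [circleMap, Complex.exp_ofReal_mul_I_im]
    have hpos := cayley_re_pos hz
    have hnz := Complex.normSq_pos.2 (one_sub_ne_zero_of_norm_lt hz)
    have hκ := discToSlitPlane_im ((r n : ℂ) * circleMap 0 1 t)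
    have h := posSemidef_symm_im (hFim _ (discToSlitPlane_mem hz))
    set κ : ℝ := 4 * ((1 + (r n : ℂ) * circleMap 0 1 t) / (1 - (r n : ℂ) * circleMap 0 1 t)).re /
      Complex.normSq (1 - (r n : ℂ) * circleMap 0 1 t)
    have hκ0 : 0 < κ := div_pos (by linarith) hnz
    have h' := h.smul (a := (4 * Real.pi * κ * r n)⁻¹)
      (inv_nonneg.2 (by have := (hr n).1; positivity))
    convert h' using 1
    ext i j
    have h1 := (hr n).1.ne'
    simp only [ρ, G, Matrix.of_apply, Matrix.smul_apply, smul_eq_mul, hκ, him]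
    field_simp
  have hρint : ∀ n (w : ℝ) i j, |w| < 1 →
      ∫ t in Ioc 0 (2 * Real.pi), 4 * w / ((1 - w) ^ 2 + 4 * w * p t) * ρ n t i j =
        A 1 i j - A (((1 + r n * w) / (1 - r n * w)) ^ 2) i j := by
    intro n w i j hw
    have hw' : |r n * w| < 1 := by
      have := hnorm n w (by simpa using hw.le)
      rwa [← Complex.ofReal_mul, Complex.norm_real] at this
    have h := re_sub_re_eq_integral_im (hHd n i j) hw
    have h0 := hGre i j 0 (by simp)
    have h1 := hGre i j (r n * w) hw'
    simp only [Complex.ofReal_zero, add_zero, sub_zero, div_one, one_pow] at h0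
    rw [Complex.ofReal_mul] at h1
    rw [mul_zero, h0, h1] at h
    exact h.symm
  have hkc : ∀ w : ℝ, |w| < 1 →
      ContinuousOn (fun s => 4 * w / ((1 - w) ^ 2 + 4 * w * s)) (Icc 0 1) := fun w hw =>
    ContinuousOn.div (by fun_prop) (by fun_prop) fun s hs => (kernel_den_pos hw hs).ne'
  have hkpc : ∀ w : ℝ, |w| < 1 → Continuous fun t => 4 * w / ((1 - w) ^ 2 + 4 * w * p t) :=
    fun w hw => Continuous.div (by fun_prop) (by fun_prop)
      fun t => (kernel_den_pos hw (one_sub_cos_div_two_mem t)).ne'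
  have hρtr : ∀ n (w : ℝ), |w| < 1 →
      ∫ t in Ioc 0 (2 * Real.pi), 4 * w / ((1 - w) ^ 2 + 4 * w * p t) * (ρ n t).trace =
        (A 1).trace - (A (((1 + r n * w) / (1 - r n * w)) ^ 2)).trace := by
    intro n w hw
    simp only [Matrix.trace, Matrix.diag, Finset.mul_sum]
    rw [integral_finsetSum, ← Finset.sum_sub_distrib]
    · exact Finset.sum_congr rfl fun i _ => hρint n w i i hw
    · exact fun i _ => ((hkpc w hw).mul (hρc n i i)).integrableOn_Ioc
  have htrc : ∀ n, Continuous fun t => (ρ n t).trace := fun n => by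
    simp only [Matrix.trace, Matrix.diag]
    exact continuous_finsetSum _ fun i _ => hρc n i i
  have htr0 : ∀ n t, 0 ≤ (ρ n t).trace := fun n t => (hρpsd n t).trace_nonneg
  have hhalf : |(1 / 2 : ℝ)| < 1 := by rw [abs_of_pos] <;> norm_num
  -- the kernel at `w = 1 / 2` is at least `8 / 9`, which bounds the total mass
  have hmass : ∀ n, ∫ t in Ioc 0 (2 * Real.pi), (ρ n t).trace ≤ 9 / 8 * (A 1).trace := by
    intro n
    have h1 : ∫ t in Ioc 0 (2 * Real.pi), 8 / 9 * (ρ n t).trace ≤ (A 1).trace := by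
      calc _ ≤ ∫ t in Ioc 0 (2 * Real.pi),
            4 * (1 / 2) / ((1 - 1 / 2) ^ 2 + 4 * (1 / 2) * p t) * (ρ n t).trace := by
            refine integral_mono ((htrc n).const_mul _).integrableOn_Ioc
              ((hkpc _ hhalf).mul (htrc n)).integrableOn_Ioc fun t => ?_
            refine mul_le_mul_of_nonneg_right ?_ (htr0 n t)
            have hp := one_sub_cos_div_two_mem t
            change p t ∈ _ at hp
            rw [le_div_iff₀ (kernel_den_pos hhalf hp)]
            linarith [hp.2]
        _ ≤ _ := by
            rw [hρtr n _ hhalf]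
            have : 0 < ((1 + r n * (1 / 2)) / (1 - r n * (1 / 2))) ^ 2 :=
              pow_pos (div_pos (by linarith [(hr n).1]) (by linarith [(hr n).2])) 2
            linarith [(hA.posSemidef _ this).trace_nonneg]
    rw [integral_const_mul] at h1
    linarith
  have hlim : ∀ (w : ℝ) i j, |w| < 1 →
      Tendsto (fun n => A (((1 + r n * w) / (1 - r n * w)) ^ 2) i j) atTop
        (𝓝 (A (((1 + w) / (1 - w)) ^ 2) i j)) := by
    intro w i j hw
    have hc : ContinuousAt (fun z : ℝ => (G i j z).re) w :=
      Complex.continuous_re.continuousAt.comp (((hGd i j w (by simpa using hw)).continuousAt).comp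
        (f := fun z : ℝ => (z : ℂ)) Complex.continuous_ofReal.continuousAt)
    have ht : Tendsto (fun n => r n * w) atTop (𝓝 w) := by simpa using hrlim.mul_const w
    have h := hc.tendsto.comp ht
    rw [hGre i j w hw] at h
    refine h.congr fun n => hGre i j _ ?_
    have := hnorm n w (by simpa using hw.le)
    rwa [← Complex.ofReal_mul, Complex.norm_real] at this
  obtain ⟨τ, M, hτ, hτI, hMm, hMS, hM, hMtr⟩ := exists_matrix_measure_of_tendsto
    (P := volume.restrict (Ioc 0 (2 * Real.pi))) (p := p) (by fun_prop)
    one_sub_cos_div_two_mem (fun n i j => (hρc n i j).measurable) hρpsd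
    (fun n => (htrc n).integrableOn_Ioc) hmass
  refine ⟨τ, M, hτ, hτI, hMm, hMS, fun x hx => ?_⟩
  -- the real point of the disc that corresponds to `x`
  obtain ⟨w, hw, hwx, hk⟩ : ∃ w : ℝ, |w| < 1 ∧ ((1 + w) / (1 - w)) ^ 2 = x ∧
      ∀ s : ℝ, 4 * w / ((1 - w) ^ 2 + 4 * w * s) = (x - 1) / (1 - s + s * x) := by
    have hy : 0 < √x := Real.sqrt_pos.2 hx
    have hy2 : √x ^ 2 = x := Real.sq_sqrt hx.le
    set y := √x
    have hy1 : y + 1 ≠ 0 := by positivity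
    have e1 : 1 - (y - 1) / (y + 1) = 2 / (y + 1) := by field_simp; ring
    have e2 : 1 + (y - 1) / (y + 1) = 2 * y / (y + 1) := by field_simp; ring
    refine ⟨(y - 1) / (y + 1), ?_, ?_, fun s => ?_⟩
    · rw [abs_lt, div_lt_one (by positivity), lt_div_iff₀ (by positivity)]
      constructor <;> linarith
    · rw [e1, e2, ← hy2]
      field_simp
    · have e3 : (2 / (y + 1)) ^ 2 + 4 * ((y - 1) / (y + 1)) * s =
          4 / (y + 1) ^ 2 * (1 - s + s * x) := by
        rw [← hy2]; field_simp; ring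
      have e4 : 4 * ((y - 1) / (y + 1)) = 4 / (y + 1) ^ 2 * (x - 1) := by
        rw [← hy2]; field_simp; ring
      rw [e1, e3, e4, mul_div_mul_left _ _ (by positivity)]
  constructor
  · intro i j
    have h := hM _ i j (A 1 i j - A x i j) (hkc w hw) (by
      simp only [hρint _ w i j hw]
      simpa only [hwx] using (hlim w i j hw).const_sub (A 1 i j))
    simp only [hk] at h
    rw [h]; ring
  · have h := hMtr _ ((A 1).trace - (A x).trace) (hkc w hw) (by
      simp only [hρtr _ w hw]
      refine Tendsto.const_sub _ ?_
      simp only [Matrix.trace, Matrix.diag]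
      simpa only [hwx] using tendsto_finsetSum _ fun i _ => hlim w i i hw)
    simp only [hk] at h
    rw [h]; ring

/-! ### Passage to the half-line -/

section HalfLine

open Filter Topology

/-- Fatou's lemma as `x → ∞`. The integrand on the left is `⊤` at `0`. -/
theorem lintegral_inv_le_of_integral_le {τ : Measure ℝ} [IsFiniteMeasure τ]
    (hτ : ∀ᵐ s ∂τ, s ∈ Icc (0 : ℝ) 1) {T : ℝ}
    (hT : ∀ x : ℝ, 0 < x → ∫ s, (x - 1) / (1 - s + s * x) ∂τ ≤ T) :
    ∫⁻ s, (ENNReal.ofReal s)⁻¹ ∂τ ≤ ENNReal.ofReal T := by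
  -- the integrand at `x = n + 2`
  let q : ℕ → ℝ → ℝ := fun n s => ((n : ℝ) + 1) / (1 + s * (n + 1))
  have hq0 : ∀ n, ∀ s ∈ Icc (0 : ℝ) 1, 0 ≤ q n s := fun n s hs => by
    have := hs.1
    positivity
  have hqT : ∀ n, ∫⁻ s, ENNReal.ofReal (q n s) ∂τ ≤ ENNReal.ofReal T := by
    intro n
    have hi : Integrable (q n) τ := by
      refine Integrable.of_bound (C := (n : ℝ) + 1)
        (Measurable.aestronglyMeasurable (by fun_prop)) ?_
      filter_upwards [hτ] with s hs
      have := hs.1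
      rw [Real.norm_eq_abs, abs_of_nonneg (hq0 n s hs)]
      exact div_le_self (by positivity) (by nlinarith [mul_nonneg this (n.cast_nonneg : (0:ℝ) ≤ n)])
    rw [← ofReal_integral_eq_lintegral_ofReal hi (hτ.mono fun s hs => hq0 n s hs)]
    refine ENNReal.ofReal_le_ofReal ((hT (n + 2) (by positivity)).trans_eq' ?_)
    refine integral_congr_ae (ae_of_all _ fun s => ?_)
    simp only [q]
    congr 1 <;> ring
  have hlim : ∀ s ∈ Icc (0 : ℝ) 1,
      Tendsto (fun n => ENNReal.ofReal (q n s)) atTop (𝓝 (ENNReal.ofReal s)⁻¹) := by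
    intro s hs
    have hcast : Tendsto (fun n : ℕ => (n : ℝ) + 1) atTop atTop :=
      tendsto_atTop_add_const_right _ _ tendsto_natCast_atTop_atTop
    rcases hs.1.eq_or_lt with h0 | h0
    · subst h0
      have h1 : (fun n => ENNReal.ofReal (q n 0)) = ENNReal.ofReal ∘ fun n : ℕ => (n : ℝ) + 1 := by
        funext n
        simp [q]
      rw [h1, ENNReal.ofReal_zero, ENNReal.inv_zero]
      exact ENNReal.tendsto_ofReal_atTop.comp hcast
    · rw [← ENNReal.ofReal_inv_of_pos h0]
      refine (ENNReal.continuous_ofReal.tendsto _).comp ?_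
      have h1 : Tendsto (fun n : ℕ => (((n : ℝ) + 1)⁻¹ + s)⁻¹) atTop (𝓝 s⁻¹) := by
        have := (hcast.inv_tendsto_atTop.add_const s).inv₀ (by simpa using h0.ne')
        simpa using this
      refine h1.congr fun n => ?_
      simp only [q]
      field_simp
  calc ∫⁻ s, (ENNReal.ofReal s)⁻¹ ∂τ
      = ∫⁻ s, liminf (fun n => ENNReal.ofReal (q n s)) atTop ∂τ :=
        lintegral_congr_ae (hτ.mono fun s hs => (hlim s hs).liminf_eq.symm)
    _ ≤ liminf (fun n => ∫⁻ s, ENNReal.ofReal (q n s) ∂τ) atTop :=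
        lintegral_liminf_le fun n => by fun_prop
    _ ≤ ENNReal.ofReal T := by
        refine (liminf_le_liminf (Eventually.of_forall hqT)).trans ?_
        simp

theorem ae_pos_and_integrable_inv {τ : Measure ℝ} (hτ : ∀ᵐ s ∂τ, s ∈ Icc (0 : ℝ) 1)
    (h : ∫⁻ s, (ENNReal.ofReal s)⁻¹ ∂τ ≠ ⊤) :
    (∀ᵐ s ∂τ, s ∈ Ioc (0 : ℝ) 1) ∧ Integrable (fun s => s⁻¹) τ := by
  have hpos : ∀ᵐ s ∂τ, s ∈ Ioc (0 : ℝ) 1 := by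
    filter_upwards [hτ, ae_lt_top (by fun_prop) h] with s hs hlt
    refine ⟨?_, hs.2⟩
    by_contra hle
    simp [ENNReal.ofReal_of_nonpos (not_lt.1 hle)] at hlt
  refine ⟨hpos, (by fun_prop : Measurable fun s : ℝ => s⁻¹).aestronglyMeasurable, ?_⟩
  rw [hasFiniteIntegral_iff_ofReal (hpos.mono fun s hs => inv_nonneg.2 hs.1.le),
    lintegral_congr_ae (hpos.mono fun s hs => ENNReal.ofReal_inv_of_pos hs.1)]
  exact h.lt_top

/-- The kernel `s⁻² / (x + (s⁻¹ - 1))` on `]0, 1]`: the Stieltjes kernel `1 / (x + r)` at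
`r = s⁻¹ - 1`, times the density `s⁻²` used in `halfLineMeasure`. -/
noncomputable def stieltjesKernel (x s : ℝ) : ℝ := s⁻¹ ^ 2 * (x + (s⁻¹ - 1))⁻¹

theorem stieltjesKernel_eq {x s : ℝ} (hx : 0 < x) (hs : s ∈ Ioc (0 : ℝ) 1) :
    stieltjesKernel x s = s⁻¹ * (1 - s + s * x)⁻¹ := by
  have h0 := hs.1
  have h1 : 0 < 1 - s + s * x := by nlinarith [hs.2, mul_pos h0 hx]
  have h2 : x + (s⁻¹ - 1) = s⁻¹ * (1 - s + s * x) := by field_simp; ring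
  rw [stieltjesKernel, h2, mul_inv, inv_inv]
  field_simp

theorem div_eq_inv_sub_stieltjesKernel {x s : ℝ} (hx : 0 < x) (hs : s ∈ Ioc (0 : ℝ) 1) :
    (x - 1) / (1 - s + s * x) = s⁻¹ - stieltjesKernel x s := by
  have h0 := hs.1
  have h1 : 0 < 1 - s + s * x := by nlinarith [hs.2, mul_pos h0 hx]
  rw [stieltjesKernel_eq hx hs, div_eq_iff h1.ne', sub_mul, mul_assoc, inv_mul_cancel₀ h1.ne']
  field_simp
  ring

theorem abs_stieltjesKernel_le {x s : ℝ} (hx : 0 < x) (hs : s ∈ Ioc (0 : ℝ) 1) :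
    |stieltjesKernel x s| ≤ (min 1 x)⁻¹ * s⁻¹ := by
  have h0 := hs.1
  have hm : 0 < min 1 x := lt_min one_pos hx
  have h1 : min 1 x ≤ 1 - s + s * x := by
    nlinarith [hs.2, min_le_left 1 x, min_le_right 1 x,
      mul_le_mul_of_nonneg_left (min_le_right 1 x) h0.le,
      mul_le_mul_of_nonneg_left (min_le_left 1 x) (sub_nonneg.2 hs.2)]
  have h2 : 0 < 1 - s + s * x := hm.trans_le h1
  rw [stieltjesKernel_eq hx hs, abs_of_nonneg (by positivity), mul_comm]
  exact mul_le_mul_of_nonneg_right (inv_anti₀ hm h1) (by positivity)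

theorem measurable_stieltjesKernel (x : ℝ) : Measurable (stieltjesKernel x) := by
  unfold stieltjesKernel
  fun_prop

/-- The image on `]0, ∞[` of `s⁻² τ(ds)`, restricted to `]0, 1[`, under `s ↦ s⁻¹ - 1`. -/
noncomputable def halfLineMeasure (τ : Measure ℝ) : Measure ℝ :=
  ((τ.restrict (Ioo 0 1)).withDensity fun s => ENNReal.ofReal (s⁻¹ ^ 2)).map fun s => s⁻¹ - 1

theorem measurable_inv_sub_one : Measurable fun s : ℝ => s⁻¹ - 1 := by fun_prop

theorem halfLineMeasure_Iic (τ : Measure ℝ) : halfLineMeasure τ (Iic 0) = 0 := by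
  rw [halfLineMeasure, Measure.map_apply measurable_inv_sub_one measurableSet_Iic,
    withDensity_apply _ (measurable_inv_sub_one measurableSet_Iic),
    Measure.restrict_restrict (measurable_inv_sub_one measurableSet_Iic)]
  have : (fun s : ℝ => s⁻¹ - 1) ⁻¹' Iic 0 ∩ Ioo 0 1 = ∅ := by
    refine eq_empty_of_forall_notMem fun s hs => ?_
    have h1 := (one_lt_inv₀ hs.2.1).2 hs.2.2
    have h2 : s⁻¹ - 1 ≤ 0 := hs.1
    linarith
  simp [this]

theorem lintegral_halfLineMeasure (τ : Measure ℝ) {f : ℝ → ENNReal} (hf : Measurable f) :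
    ∫⁻ r, f r ∂halfLineMeasure τ =
      ∫⁻ s in Ioo 0 1, ENNReal.ofReal (s⁻¹ ^ 2) * f (s⁻¹ - 1) ∂τ := by
  rw [halfLineMeasure, lintegral_map hf measurable_inv_sub_one,
    lintegral_withDensity_eq_lintegral_mul _ (by fun_prop) (by fun_prop)]
  rfl

theorem lintegral_halfLineMeasure_lt_top {τ : Measure ℝ}
    (h : ∫⁻ s, (ENNReal.ofReal s)⁻¹ ∂τ ≠ ⊤) :
    ∫⁻ r, ENNReal.ofReal (1 + r)⁻¹ ∂halfLineMeasure τ < ⊤ := by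
  rw [lintegral_halfLineMeasure τ (by fun_prop)]
  refine lt_of_le_of_lt ?_ h.lt_top
  refine le_trans ?_ (setLIntegral_le_lintegral (Ioo 0 1) _)
  refine setLIntegral_mono_ae (by fun_prop) (ae_of_all _ fun s hs => ?_)
  have h0 := hs.1
  rw [← ENNReal.ofReal_mul (by positivity), ← ENNReal.ofReal_inv_of_pos h0]
  refine ENNReal.ofReal_le_ofReal (le_of_eq ?_)
  rw [add_sub_cancel, inv_inv]
  field_simp

theorem isFiniteMeasureOnCompacts_of_lintegral_lt_top {μ : Measure ℝ} (h0 : μ (Iic 0) = 0)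
    (h : ∫⁻ r, ENNReal.ofReal (1 + r)⁻¹ ∂μ < ⊤) : IsFiniteMeasureOnCompacts μ := by
  refine ⟨fun Q hQ => ?_⟩
  obtain ⟨R, hR⟩ := hQ.isBounded.subset_closedBall 0
  have hQR : Q ⊆ Iic 0 ∪ {r | ENNReal.ofReal (1 + |R|)⁻¹ ≤ ENNReal.ofReal (1 + r)⁻¹} := by
    intro r hr
    rcases le_or_gt r 0 with h | h
    · exact Or.inl h
    · refine Or.inr (ENNReal.ofReal_le_ofReal (inv_anti₀ (by positivity) ?_))
      have := hR hr
      rw [mem_closedBall_zero_iff, Real.norm_eq_abs] at this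
      linarith [le_abs_self r, le_abs_self R]
  have hpos : ENNReal.ofReal (1 + |R|)⁻¹ ≠ 0 := by
    rw [Ne, ENNReal.ofReal_eq_zero, not_le]; positivity
  calc μ Q ≤ μ (Iic 0) + μ {r | ENNReal.ofReal (1 + |R|)⁻¹ ≤ ENNReal.ofReal (1 + r)⁻¹} :=
        (measure_mono hQR).trans (measure_union_le _ _)
    _ < ⊤ := by
        rw [h0, zero_add]
        exact (meas_ge_le_lintegral_div (by fun_prop) hpos ENNReal.ofReal_ne_top).trans_lt
          (ENNReal.div_lt_top h.ne hpos)

theorem integrable_halfLineMeasure_iff (τ : Measure ℝ) {f : ℝ → ℝ} (hf : Measurable f) :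
    Integrable f (halfLineMeasure τ) ↔
      IntegrableOn (fun s => s⁻¹ ^ 2 * f (s⁻¹ - 1)) (Ioo 0 1) τ := by
  rw [halfLineMeasure, integrable_map_measure hf.aestronglyMeasurable
    measurable_inv_sub_one.aemeasurable,
    integrable_withDensity_iff_integrable_smul' (by fun_prop) (by simp), IntegrableOn]
  refine iff_of_eq (congrArg (fun g => Integrable g _) (funext fun s => ?_))
  rw [ENNReal.toReal_ofReal (by positivity)]
  rfl

theorem integral_halfLineMeasure (τ : Measure ℝ) {f : ℝ → ℝ} (hf : Measurable f) :
    ∫ r, f r ∂halfLineMeasure τ = ∫ s in Ioo 0 1, s⁻¹ ^ 2 * f (s⁻¹ - 1) ∂τ := by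
  rw [halfLineMeasure, integral_map measurable_inv_sub_one.aemeasurable hf.aestronglyMeasurable,
    integral_withDensity_eq_integral_toReal_smul (by fun_prop) (by simp)]
  refine integral_congr_ae (ae_of_all _ fun s => ?_)
  simp only [smul_eq_mul]
  rw [ENNReal.toReal_ofReal (by positivity)]

end HalfLine

/-! ### The Stieltjes representation -/

open Filter Topology in
theorem mainTheorem6 (d : ℕ) (A : ℝ → Matrix (Fin d) (Fin d) ℝ) (hA : IsMatrixStieltjes A) :
    ∃ (B C : Matrix (Fin d) (Fin d) ℝ) (μ : Measure ℝ) (M : ℝ → Matrix (Fin d) (Fin d) ℝ),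
      B.PosSemidef ∧ C.PosSemidef ∧
      -- `μ` is a positive Radon measure carried by `]0, ∞[`
      μ.Regular ∧ μ (Iic 0) = 0 ∧
      (∫⁻ r in Ioi (0 : ℝ), ENNReal.ofReal (1 + r)⁻¹ ∂μ) < ⊤ ∧
      (∀ i j, Measurable fun s => M s i j) ∧
      (∃ K : ℝ, ∀ᵐ s ∂μ, ∀ i j, |M s i j| ≤ K) ∧
      (∀ᵐ s ∂μ, (M s).PosSemidef) ∧
      ∀ x : ℝ, 0 < x →
        (∀ i j, IntegrableOn (fun s => ((x + s)⁻¹ • M s) i j) (Ioi 0) μ) ∧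
        A x = B + x⁻¹ • C + matrixIntegral μ (fun s => (x + s)⁻¹ • M s) := by
  obtain ⟨τ, N, hτ, hτI, hNm, hNS, hAτ⟩ := hA.exists_unitInterval_representation
  have hfin : ∫⁻ s, (ENNReal.ofReal s)⁻¹ ∂τ ≠ ⊤ := by
    refine ((lintegral_inv_le_of_integral_le hτI (T := (A 1).trace) fun x hx => ?_).trans_lt
      ENNReal.ofReal_lt_top).ne
    linarith [(hAτ x hx).2, (hA.posSemidef x hx).trace_nonneg]
  obtain ⟨hτpos, hinv⟩ := ae_pos_and_integrable_inv hτI hfin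
  have hNij : ∀ i j, Measurable fun s => N s i j := fun i j => by fun_prop
  have hinvN : ∀ i j, Integrable (fun s => s⁻¹ * N s i j) τ := fun i j =>
    hinv.mul_bdd (c := 1) (hNij i j).aestronglyMeasurable (ae_of_all _ fun s => (hNS s).2 i j)
  have hkN : ∀ x, 0 < x → ∀ i j, Integrable (fun s => stieltjesKernel x s * N s i j) τ := by
    intro x hx i j
    refine Integrable.mul_bdd (c := 1) ?_ (hNij i j).aestronglyMeasurable
      (ae_of_all _ fun s => (hNS s).2 i j)
    exact (hinv.const_mul _).mono' (measurable_stieltjesKernel x).aestronglyMeasurable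
      (hτpos.mono fun s hs => abs_stieltjesKernel_le hx hs)
  let B : Matrix (Fin d) (Fin d) ℝ := Matrix.of fun i j => A 1 i j - ∫ s, s⁻¹ * N s i j ∂τ
  have hAB : ∀ x, 0 < x → ∀ i j, A x i j = B i j + ∫ s, stieltjesKernel x s * N s i j ∂τ := by
    intro x hx i j
    have h : ∫ s, (x - 1) / (1 - s + s * x) * N s i j ∂τ =
        ∫ s, (s⁻¹ * N s i j - stieltjesKernel x s * N s i j) ∂τ :=
      integral_congr_ae (hτpos.mono fun s hs => by
        simp only [div_eq_inv_sub_stieltjesKernel hx hs, sub_mul])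
    rw [(hAτ x hx).1 i j, h, integral_sub (hinvN i j) (hkN x hx i j)]
    simp only [B, Matrix.of_apply]
    ring
  -- `B` is the limit of `A` at infinity, by dominated convergence
  have hlim : Tendsto (fun n : ℕ => (A ((n : ℝ) + 1) : Fin d → Fin d → ℝ)) atTop (𝓝 B) := by
    refine tendsto_pi_nhds.2 fun i => tendsto_pi_nhds.2 fun j => ?_
    have hpos : ∀ n : ℕ, (0 : ℝ) < (n : ℝ) + 1 := fun n => by positivity
    simp only [hAB _ (hpos _)]
    have h0 : Tendsto (fun n : ℕ => ∫ s, stieltjesKernel ((n : ℝ) + 1) s * N s i j ∂τ) atTop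
        (𝓝 (∫ _, (0 : ℝ) ∂τ)) := by
      refine tendsto_integral_of_dominated_convergence (fun s => s⁻¹)
        (fun n => (hkN _ (hpos n) i j).aestronglyMeasurable) hinv (fun n => ?_) ?_
      · filter_upwards [hτpos] with s hs
        have h1 := abs_stieltjesKernel_le (hpos n) hs
        rw [min_eq_left (by simp), inv_one, one_mul] at h1
        rw [Real.norm_eq_abs, abs_mul]
        exact (mul_le_of_le_one_right (abs_nonneg _) ((hNS s).2 i j)).trans h1
      · refine ae_of_all _ fun s => ?_
        have h2 : Tendsto (fun n : ℕ => (n : ℝ) + 1 + (s⁻¹ - 1)) atTop atTop :=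
          tendsto_atTop_add_const_right _ _
            (tendsto_atTop_add_const_right _ _ tendsto_natCast_atTop_atTop)
        have h3 := (h2.inv_tendsto_atTop.const_mul (s⁻¹ ^ 2)).mul_const (N s i j)
        simp only [Pi.inv_apply, mul_zero, zero_mul] at h3
        exact h3
    simpa using h0.const_add (B i j)
  have hB : B.PosSemidef := isClosed_posSemidef.mem_of_tendsto hlim
    (Eventually.of_forall fun n => hA.posSemidef _ (by positivity))
  have hμ0 := halfLineMeasure_Iic τ
  have hμfin := lintegral_halfLineMeasure_lt_top hfin
  have hμr : (halfLineMeasure τ).restrict (Ioi 0) = halfLineMeasure τ :=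
    Measure.restrict_eq_self_of_ae_mem (by
      rw [ae_iff]
      simpa [Iic_def] using hμ0)
  -- a locally finite measure on `ℝ` is regular
  have := isFiniteMeasureOnCompacts_of_lintegral_lt_top hμ0 hμfin
  refine ⟨B, τ.real {1} • Matrix.of (N 1), halfLineMeasure τ,
    fun s => Matrix.of (N (1 + s)⁻¹), hB, (hNS 1).1.smul measureReal_nonneg, inferInstance, hμ0,
    by rwa [hμr], fun i j => (hNij i j).comp (by fun_prop : Measurable fun s : ℝ => (1 + s)⁻¹),
    ⟨1, ae_of_all _ fun s i j => (hNS _).2 i j⟩, ae_of_all _ fun s => (hNS _).1, fun x hx => ?_⟩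
  have hfm : ∀ i j, Measurable fun s : ℝ => (x + s)⁻¹ * N (1 + s)⁻¹ i j := fun i j =>
    Measurable.mul (by fun_prop)
      ((hNij i j).comp (by fun_prop : Measurable fun s : ℝ => (1 + s)⁻¹))
  have hpull : ∀ i j, (fun s : ℝ => s⁻¹ ^ 2 * ((x + (s⁻¹ - 1))⁻¹ * N (1 + (s⁻¹ - 1))⁻¹ i j)) =
      fun s => stieltjesKernel x s * N s i j := fun i j => by
    funext s
    rw [add_sub_cancel, inv_inv, stieltjesKernel, mul_assoc]
  constructor
  · intro i j
    rw [IntegrableOn, hμr]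
    refine (integrable_halfLineMeasure_iff τ (hfm i j)).2 ?_
    rw [hpull]
    exact (hkN x hx i j).integrableOn
  · ext i j
    simp only [matrixIntegral, Matrix.add_apply, Matrix.smul_apply, Matrix.of_apply, smul_eq_mul,
      hμr]
    rw [integral_halfLineMeasure τ (hfm i j), hpull, hAB x hx i j, add_assoc]
    congr 1
    have hk := hkN x hx i j
    -- split off the atom of `τ` at `1`, which is the term `x⁻¹ • C`
    rw [← Measure.restrict_eq_self_of_ae_mem hτpos,
      ← Ioo_union_right (zero_lt_one (α := ℝ)), setIntegral_union (by simp)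
        (measurableSet_singleton 1) hk.integrableOn hk.integrableOn, integral_singleton,
      Ioo_union_right (zero_lt_one (α := ℝ)), Measure.restrict_eq_self_of_ae_mem hτpos,
      stieltjesKernel]
    simp
    ring
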